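/- Let $|0\rangle,|1\rangle$ be the standard basis of $\mathbb{C}^2$, and for $\theta\in\mathbb{R}$ let $|\theta\rangle=\cos\frac{\theta}{2}|0\rangle+\sin\frac{\theta}{2}|1\rangle$. Let $\mathbb{RP}^1=\{|\theta\rangle\langle\theta| : \theta\in\mathbb{R}\}$ be the set of real one-dimensional projectors on $\mathbb{C}^2$. For an operator $\rho_{AB}$ on $\mathbb{C}^2\otimes\mathbb{C}^2$ put $\tilde\rho_B(\theta)=\mathrm{Tr}_A\big[(|\theta\rangle\langle\theta|\otimes\mathbb{I})\rho_{AB}\big]$. A two-qubit state $\rho_{AB}$ with real matrix entries is called RP-unsteerable if there is a local hidden state model for all real projective measurements $\{|\theta\rangle\langle\theta|,|\theta+\pi\rangle\langle\theta+\pi|\}$ of Alice, that is, a Borel probability measure $\mu$ on $\mathbb{RP}^1$ and measurable functions $f_{\theta,0},f_{\theta,1}\colon\mathbb{RP}^1\to[0,1]$ $(\theta\in\mathbb{R})$ with $f_{\theta,0}+f_{\theta,1}=1$ such that $$\tilde\rho_B(\theta+a\pi)=\int_{\mathbb{RP}^1}x\,f_{\theta,a}(x)\,\mathrm{d}\mu(x)\qquad\text{for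 all }\theta\in\mathbb{R},\ a\in\{0,1\};$$ otherwise it is called RP-steerable. Theorem. For $\eta\in[0,1]$ let $\rho_{AB}(\eta)=\eta\,|\Phi_+\rangle\langle\Phi_+|+(1-\eta)\,\mathbb{I}/4$ be the Werner state, where $|\Phi_+\rangle=\frac{1}{\sqrt2}(|00\rangle+|11\rangle)$. Then $\rho_{AB}(\eta)$ is RP-unsteerable if $\eta\le\frac{2}{\pi}$, and RP-steerable if $\eta>\frac{2}{\pi}$. -/

import Mathlib

open MeasureTheory
open scoped Kronecker

noncomputable section

/-- Operators on the qubit space `ℂ²`, in the standard basis `|0⟩, |1⟩`. -/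
abbrev QubitOp : Type := Matrix (Fin 2) (Fin 2) ℂ

/-- Operators on `ℂ² ⊗ ℂ²`, in the standard basis `|ij⟩`; the first index belongs to Alice,
the second to Bob. -/
abbrev TwoQubitOp : Type := Matrix (Fin 2 × Fin 2) (Fin 2 × Fin 2) ℂ

/-- The outer product `|ψ⟩⟨ψ|`. -/
def ketbra {ι : Type*} (ψ : ι → ℂ) : Matrix ι ι ℂ := Matrix.vecMulVec ψ (star ψ)

/-- The tensor product `|u⟩ ⊗ |v⟩`. -/
def tensorKet (u v : Fin 2 → ℂ) : Fin 2 × Fin 2 → ℂ := fun p => u p.1 * v p.2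

/-- The basis vector `|0⟩`. -/
def ket0 : Fin 2 → ℂ := ![1, 0]

/-- The basis vector `|1⟩`. -/
def ket1 : Fin 2 → ℂ := ![0, 1]

/-- The real unit vector `|θ⟩ = cos (θ/2) |0⟩ + sin (θ/2) |1⟩`. -/
def ketAngle (θ : ℝ) : Fin 2 → ℂ :=
  ((Real.cos (θ / 2) : ℝ) : ℂ) • ket0 + ((Real.sin (θ / 2) : ℝ) : ℂ) • ket1

/-- The set `ℝP¹` of real one-dimensional projectors on `ℂ²`, i.e. of all `|θ⟩⟨θ|`. -/
def RP1 : Set QubitOp := Set.range fun θ : ℝ => ketbra (ketAngle θ)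

/-- `ℝP¹` carries the Borel σ-algebra of its topology as a set of `2 × 2` matrices. -/
instance RP1.instMeasurableSpace : MeasurableSpace RP1 := borel RP1

instance RP1.instBorelSpace : BorelSpace RP1 := ⟨rfl⟩

/-- The partial trace over Alice's qubit. -/
def partialTraceA (M : TwoQubitOp) : QubitOp :=
  Matrix.of fun i j => ∑ k : Fin 2, M (k, i) (k, j)

/-- The subnormalized state of Bob `Tr_A [(|θ⟩⟨θ| ⊗ I) ρ]`. -/
def steeringEllipse (ρ : TwoQubitOp) (θ : ℝ) : QubitOp :=
  partialTraceA ((ketbra (ketAngle θ) ⊗ₖ (1 : QubitOp)) * ρ)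

/-- The operator `∫ x f(x) dμ(x)` for a measure `μ` on `ℝP¹` (the integral is taken entrywise). -/
def boxIntegral (μ : Measure RP1) (f : RP1 → ℝ) : QubitOp :=
  Matrix.of fun i j => ∫ x : RP1, (x : QubitOp) i j * ((f x : ℝ) : ℂ) ∂μ

/-- The family `σ q a` of subnormalized states (`q` a measurement of Alice, `a` an outcome) has a
local hidden state model: a probability distribution `μ` on `ℝP¹` and response functions
`f q a : ℝP¹ → [0, 1]` with `∑ a, f q a x = 1` that reproduce all of the `σ q a`. -/
def HasLHSModel {Q A : Type*} [Fintype A] (σ : Q → A → QubitOp) : Prop :=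
  ∃ (μ : Measure RP1) (f : Q → A → RP1 → ℝ),
    IsProbabilityMeasure μ ∧
    (∀ q a, Measurable (f q a)) ∧
    (∀ q a x, f q a x ∈ Set.Icc (0 : ℝ) 1) ∧
    (∀ q x, ∑ a, f q a x = 1) ∧
    (∀ q a, σ q a = boxIntegral μ (f q a))

/-- Bob's subnormalized states when Alice performs the real projective measurement
`{|θ⟩⟨θ|, |θ + π⟩⟨θ + π|}`: outcome `0` belongs to `|θ⟩⟨θ|` and outcome `1` to `|θ + π⟩⟨θ + π|`. -/
def realProjectiveAssemblage (ρ : TwoQubitOp) : ℝ → Fin 2 → QubitOp :=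
  fun θ a => steeringEllipse ρ (θ + (a : ℕ) * Real.pi)

/-- `ρ` is RP-unsteerable: one local hidden state model covers all real projective measurements. -/
def RPUnsteerable (ρ : TwoQubitOp) : Prop := HasLHSModel (realProjectiveAssemblage ρ)

/-- `ρ` is RP-steerable: there is no such model. -/
def RPSteerable (ρ : TwoQubitOp) : Prop := ¬ RPUnsteerable ρ

/-- The maximally entangled vector `|Φ₊⟩ = (|00⟩ + |11⟩) / √2`. -/
def phiPlus : Fin 2 × Fin 2 → ℂ :=
  ((1 / Real.sqrt 2 : ℝ) : ℂ) • (tensorKet ket0 ket0 + tensorKet ket1 ket1)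

/-- The Werner state `η |Φ₊⟩⟨Φ₊| + (1 - η) I / 4`. -/
def wernerState (η : ℝ) : TwoQubitOp :=
  (η : ℂ) • ketbra phiPlus + (((1 - η) / 4 : ℝ) : ℂ) • (1 : TwoQubitOp)

end

/-! ### Bloch coordinates on `ℝP¹` -/

/-! In Bloch coordinates `ℝP¹` is the unit circle, and Bob's states for the Werner state have trace
1/2 and Bloch vector ±(η/2)(cos θ, sin θ). Both directions rest on the mean of |cos| over the circle
being 2/π. Model: with uniform hidden states, answering by the sign of cos (φ - θ) produces
visibility 2/π; damping the sign by a factor s ≤ 1 reaches every smaller η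
(`boxIntegral_uniformRP1`). Bound: in any model, pairing the difference of the two outcomes with the
direction θ gives η ≤ ∫ |cos (φ - θ)| dμ (`integral_blochDot_mul`). Averaging over θ makes the right
side 2/π whatever μ is (`integral_integral_abs_blochDot`). -/

theorem ketbra_ketAngle (θ : ℝ) :
    ketbra (ketAngle θ) =
      !![(((1 + Real.cos θ) / 2 : ℝ) : ℂ), ((Real.sin θ / 2 : ℝ) : ℂ);
        ((Real.sin θ / 2 : ℝ) : ℂ), (((1 - Real.cos θ) / 2 : ℝ) : ℂ)] := by
  obtain ⟨t, rfl⟩ : ∃ t, θ = 2 * t := ⟨θ / 2, by ring⟩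
  have ht : 2 * t / 2 = t := by ring
  have h1 := Real.sin_sq_add_cos_sq t
  rw [Real.cos_two_mul, Real.sin_two_mul]
  ext i j
  fin_cases i <;> fin_cases j <;>
    simp only [ketbra, ketAngle, ket0, ket1, ht, Matrix.vecMulVec_apply, Pi.add_apply,
      Pi.smul_apply, Pi.star_apply, smul_eq_mul, Matrix.of_apply, Matrix.cons_val',
      Matrix.cons_val_zero, Matrix.cons_val_one, Fin.zero_eta, Fin.mk_one, Fin.isValue,
      Matrix.cons_val_fin_one, mul_one, mul_zero, add_zero, zero_add, Complex.star_def,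
      Complex.conj_ofReal, ← Complex.ofReal_mul, Complex.ofReal_inj] <;> linarith

/-- The projector `|φ⟩⟨φ|` as a point of `ℝP¹`. -/
noncomputable def angleProj (φ : ℝ) : RP1 := ⟨ketbra (ketAngle φ), φ, rfl⟩

/-- The coordinate `Tr (Z x) = cos φ` of `x = |φ⟩⟨φ|`. -/
noncomputable def blochZ (x : RP1) : ℝ := ((x : QubitOp) 0 0).re - ((x : QubitOp) 1 1).re

/-- The coordinate `Tr (X x) = sin φ` of `x = |φ⟩⟨φ|`. -/
noncomputable def blochX (x : RP1) : ℝ := 2 * ((x : QubitOp) 0 1).re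

theorem blochZ_angleProj (φ : ℝ) : blochZ (angleProj φ) = Real.cos φ := by
  simp only [blochZ, angleProj, ketbra_ketAngle, Matrix.of_apply, Matrix.cons_val',
    Matrix.cons_val_zero, Matrix.cons_val_one, Matrix.cons_val_fin_one, Complex.ofReal_re]
  ring

theorem blochX_angleProj (φ : ℝ) : blochX (angleProj φ) = Real.sin φ := by
  simp only [blochX, angleProj, ketbra_ketAngle, Matrix.of_apply, Matrix.cons_val',
    Matrix.cons_val_zero, Matrix.cons_val_one, Matrix.cons_val_fin_one, Complex.ofReal_re]
  ring

theorem exists_angleProj_eq (x : RP1) : ∃ φ, angleProj φ = x := by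
  obtain ⟨_, φ, rfl⟩ := x
  exact ⟨φ, rfl⟩

theorem coe_eq_bloch (x : RP1) :
    (x : QubitOp) =
      !![(((1 + blochZ x) / 2 : ℝ) : ℂ), ((blochX x / 2 : ℝ) : ℂ);
        ((blochX x / 2 : ℝ) : ℂ), (((1 - blochZ x) / 2 : ℝ) : ℂ)] := by
  obtain ⟨φ, rfl⟩ := exists_angleProj_eq x
  rw [blochZ_angleProj, blochX_angleProj]
  exact ketbra_ketAngle φ

theorem continuous_re_entry (i j : Fin 2) : Continuous fun x : RP1 => ((x : QubitOp) i j).re :=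
  Complex.continuous_re.comp (continuous_subtype_val.matrix_elem i j)

theorem continuous_blochZ : Continuous blochZ :=
  (continuous_re_entry 0 0).sub (continuous_re_entry 1 1)

theorem continuous_blochX : Continuous blochX :=
  continuous_const.mul (continuous_re_entry 0 1)

theorem measurable_blochZ : Measurable blochZ := continuous_blochZ.measurable

theorem measurable_blochX : Measurable blochX := continuous_blochX.measurable

theorem continuous_ketAngle : Continuous ketAngle := by unfold ketAngle; fun_prop

theorem continuous_angleProj : Continuous angleProj := by
  refine Continuous.subtype_mk ?_ _
  unfold ketbra
  exact continuous_ketAngle.matrix_vecMulVec continuous_ketAngle.star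

/-- The overlap `cos (φ - θ)` of the Bloch vectors of `x = |φ⟩⟨φ|` and `|θ⟩⟨θ|`. -/
noncomputable def blochDot (θ : ℝ) (x : RP1) : ℝ := Real.cos θ * blochZ x + Real.sin θ * blochX x

theorem blochDot_angleProj (θ φ : ℝ) : blochDot θ (angleProj φ) = Real.cos (φ - θ) := by
  rw [blochDot, blochZ_angleProj, blochX_angleProj, Real.cos_sub]; ring

theorem measurable_blochDot (θ : ℝ) : Measurable (blochDot θ) :=
  (measurable_blochZ.const_mul _).add (measurable_blochX.const_mul _)

theorem abs_blochDot_le_one (θ : ℝ) (x : RP1) : |blochDot θ x| ≤ 1 := by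
  obtain ⟨φ, rfl⟩ := exists_angleProj_eq x
  rw [blochDot_angleProj]
  exact Real.abs_cos_le_one _

theorem abs_blochZ_le_one (x : RP1) : |blochZ x| ≤ 1 := by
  obtain ⟨φ, rfl⟩ := exists_angleProj_eq x
  rw [blochZ_angleProj]
  exact Real.abs_cos_le_one _

theorem abs_blochX_le_one (x : RP1) : |blochX x| ≤ 1 := by
  obtain ⟨φ, rfl⟩ := exists_angleProj_eq x
  rw [blochX_angleProj]
  exact Real.abs_sin_le_one _

/-! ### Bob's states for the Werner state -/

theorem steeringEllipse_wernerState (η θ : ℝ) :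
    steeringEllipse (wernerState η) θ =
      !![(((1 + η * Real.cos θ) / 4 : ℝ) : ℂ), ((η * Real.sin θ / 4 : ℝ) : ℂ);
        ((η * Real.sin θ / 4 : ℝ) : ℂ), (((1 - η * Real.cos θ) / 4 : ℝ) : ℂ)] := by
  have h2 : ((Real.sqrt 2 : ℝ) : ℂ)⁻¹ * ((Real.sqrt 2 : ℝ) : ℂ)⁻¹ = 1 / 2 := by
    rw [← Complex.ofReal_inv, ← Complex.ofReal_mul, ← mul_inv, Real.mul_self_sqrt (by norm_num)]
    norm_num
  rw [steeringEllipse, ketbra_ketAngle]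
  ext i j
  fin_cases i <;> fin_cases j <;>
    simp [partialTraceA, Matrix.mul_apply, Fintype.sum_prod_type, wernerState, ketbra, phiPlus,
      tensorKet, ket0, ket1, Matrix.vecMulVec_apply, Matrix.one_apply, h2] <;> ring

/-- Points of `ℝP¹` have real entries, so everything reduces to real integrals. -/
theorem boxIntegral_apply (μ : Measure RP1) (f : RP1 → ℝ) (i j : Fin 2) :
    boxIntegral μ f i j = ((∫ x : RP1, ((x : QubitOp) i j).re * f x ∂μ : ℝ) : ℂ) := by
  rw [boxIntegral, Matrix.of_apply, ← integral_complex_ofReal]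
  refine integral_congr_ae (.of_forall fun x => ?_)
  have h : (x : QubitOp) i j = (((x : QubitOp) i j).re : ℂ) := by
    rw [coe_eq_bloch x]
    fin_cases i <;> fin_cases j <;> exact (congrArg _ (Complex.ofReal_re _)).symm
  dsimp only
  rw [Complex.ofReal_mul, ← h]

/-! ### Integrals over the circle -/

theorem Real.measurable_sign : Measurable Real.sign :=
  Measurable.ite measurableSet_Iio measurable_const
    (Measurable.ite measurableSet_Ioi measurable_const measurable_const)

theorem Real.abs_sign_le_one (r : ℝ) : |Real.sign r| ≤ 1 := by
  rcases Real.sign_apply_eq r with h | h | h <;> simp [h]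

theorem integral_trig (a b c : ℝ) :
    ∫ φ in (0)..(2 * Real.pi), (a + b * Real.cos φ + c * Real.sin φ) = 2 * Real.pi * a := by
  rw [intervalIntegral.integral_add, intervalIntegral.integral_add] <;>
    first
    | exact Continuous.intervalIntegrable (by fun_prop) _ _
    | simp

theorem intervalIntegrable_trig_mul_sign (a b c θ s t : ℝ) :
    IntervalIntegrable (fun φ => (a + b * Real.cos φ + c * Real.sin φ) *
      Real.sign (Real.cos (φ - θ))) volume s t := by
  rw [intervalIntegrable_iff]
  refine Integrable.mul_bdd (c := 1) ?_ ?_ (.of_forall fun φ => Real.abs_sign_le_one _)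
  · exact intervalIntegrable_iff.1 (Continuous.intervalIntegrable (by fun_prop) _ _)
  · exact (Real.measurable_sign.comp (by fun_prop)).aestronglyMeasurable

/-- By periodicity the integral may start at θ - π/2; the sign is then +1 on the first half period
and -1 on the second, and the constant term cancels. -/
theorem integral_trig_mul_sign (a b c θ : ℝ) :
    ∫ φ in (0)..(2 * Real.pi), (a + b * Real.cos φ + c * Real.sin φ) *
      Real.sign (Real.cos (φ - θ)) = 4 * (b * Real.cos θ + c * Real.sin θ) := by
  have hpi := Real.pi_pos
  have hper : Function.Periodic (fun φ => (a + b * Real.cos φ + c * Real.sin φ) *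
      Real.sign (Real.cos (φ - θ))) (2 * Real.pi) := fun φ => by
    simp only [Real.cos_add_two_pi, Real.sin_add_two_pi, add_sub_right_comm φ]
  have hF : ∀ s t : ℝ, ∫ φ in s..t, (a + b * Real.cos φ + c * Real.sin φ) =
      a * (t - s) + b * (Real.sin t - Real.sin s) + c * (Real.cos s - Real.cos t) := fun s t => by
    rw [intervalIntegral.integral_add, intervalIntegral.integral_add] <;>
      first
      | exact Continuous.intervalIntegrable (by fun_prop) _ _
      | simp [mul_comm]
  have h := hper.intervalIntegral_add_eq 0 (θ - Real.pi / 2)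
  rw [zero_add] at h
  rw [h, ← intervalIntegral.integral_add_adjacent_intervals (b := θ + Real.pi / 2)
    (intervalIntegrable_trig_mul_sign ..) (intervalIntegrable_trig_mul_sign ..),
    -- Open intervals are needed: the sign is 0 at the end points.
    intervalIntegral.integral_congr_Ioo_of_le (a := θ - Real.pi / 2)
      (g := fun φ => a + b * Real.cos φ + c * Real.sin φ) (by linarith) ?_,
    intervalIntegral.integral_congr_Ioo_of_le (a := θ + Real.pi / 2)
      (g := fun φ => -(a + b * Real.cos φ + c * Real.sin φ)) (by linarith) ?_,
    intervalIntegral.integral_neg, hF, hF,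
    Real.sin_add_two_pi, Real.cos_add_two_pi, Real.sin_sub_pi_div_two, Real.cos_sub_pi_div_two,
    Real.sin_add_pi_div_two, Real.cos_add_pi_div_two]
  · ring
  · intro φ hφ
    have : Real.cos (φ - θ) < 0 :=
      Real.cos_neg_of_pi_div_two_lt_of_lt (by linarith [hφ.1]) (by linarith [hφ.2])
    simp [Real.sign_of_neg this]
  · intro φ hφ
    have : 0 < Real.cos (φ - θ) :=
      Real.cos_pos_of_mem_Ioo ⟨by linarith [hφ.1], by linarith [hφ.2]⟩
    simp [Real.sign_of_pos this]

/-- Since |t| = t · sign t, this is `integral_trig_mul_sign` with the coefficients of cos (θ - φ).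
-/
theorem integral_abs_cos_sub (φ : ℝ) :
    ∫ θ in (0)..(2 * Real.pi), |Real.cos (φ - θ)| = 4 := by
  have h := integral_trig_mul_sign 0 (Real.cos φ) (Real.sin φ) φ
  have h1 := Real.sin_sq_add_cos_sq φ
  rw [show 4 * (Real.cos φ * Real.cos φ + Real.sin φ * Real.sin φ) = 4 by linarith] at h
  rw [← h]
  refine intervalIntegral.integral_congr fun θ _ => ?_
  rw [zero_add, ← Real.cos_sub, ← Real.cos_neg (θ - φ), neg_sub]
  rcases lt_trichotomy (Real.cos (φ - θ)) 0 with h | h | h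
  · rw [Real.sign_of_neg h, abs_of_neg h]; ring
  · simp [h]
  · rw [Real.sign_of_pos h, abs_of_pos h]; ring

/-! ### The uniform hidden state model -/

/-- The rotation invariant probability measure on `ℝP¹`. -/
noncomputable def uniformRP1 : Measure RP1 :=
  (ProbabilityTheory.cond volume (Set.Ioc 0 (2 * Real.pi))).map angleProj

instance isProbabilityMeasure_uniformRP1 : IsProbabilityMeasure uniformRP1 := by
  have : IsProbabilityMeasure
      (ProbabilityTheory.cond (volume : Measure ℝ) (Set.Ioc 0 (2 * Real.pi))) :=
    ProbabilityTheory.cond_isProbabilityMeasure_of_finite (by simp [Real.pi_pos])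
      measure_Ioc_lt_top.ne
  exact Measure.isProbabilityMeasure_map continuous_angleProj.measurable.aemeasurable

theorem integral_uniformRP1 {F : RP1 → ℝ} (hF : Measurable F) :
    ∫ x, F x ∂uniformRP1 =
      (2 * Real.pi)⁻¹ * ∫ φ in (0)..(2 * Real.pi), F (angleProj φ) := by
  rw [uniformRP1, integral_map continuous_angleProj.measurable.aemeasurable
    hF.aestronglyMeasurable, ProbabilityTheory.cond, integral_smul_measure,
    intervalIntegral.integral_of_le Real.two_pi_pos.le]
  simp [Real.pi_pos.le]

/-- Each matrix entry of a point of `ℝP¹` is affine in its Bloch coordinates, so this one formula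
serves all entries. -/
theorem integral_uniformRP1_bloch_mul_response (a b c s θ : ℝ) :
    ∫ x, (a + b * blochZ x + c * blochX x) * ((1 + s * Real.sign (blochDot θ x)) / 2)
      ∂uniformRP1 = a / 2 + s / Real.pi * (b * Real.cos θ + c * Real.sin θ) := by
  have hZ := measurable_blochZ
  have hX := measurable_blochX
  have hS := Real.measurable_sign.comp (measurable_blochDot θ)
  have hm : Measurable fun x : RP1 => (a + b * blochZ x + c * blochX x) *
      ((1 + s * Real.sign (blochDot θ x)) / 2) :=
    ((measurable_const.add (hZ.const_mul b)).add (hX.const_mul c)).mul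
      ((measurable_const.add (hS.const_mul s)).div_const 2)
  rw [integral_uniformRP1 hm]
  simp only [blochZ_angleProj, blochX_angleProj, blochDot_angleProj]
  have h : ∀ φ : ℝ, (a + b * Real.cos φ + c * Real.sin φ) *
      ((1 + s * Real.sign (Real.cos (φ - θ))) / 2) =
      1 / 2 * (a + b * Real.cos φ + c * Real.sin φ) +
        s / 2 * ((a + b * Real.cos φ + c * Real.sin φ) * Real.sign (Real.cos (φ - θ))) :=
    fun φ => by ring
  simp only [h]
  rw [intervalIntegral.integral_add (Continuous.intervalIntegrable (by fun_prop) _ _)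
    ((intervalIntegrable_trig_mul_sign ..).const_mul _), intervalIntegral.integral_const_mul,
    intervalIntegral.integral_const_mul, integral_trig, integral_trig_mul_sign]
  have := Real.pi_ne_zero
  field_simp
  ring

theorem boxIntegral_uniformRP1 (s θ : ℝ) :
    boxIntegral uniformRP1 (fun x => (1 + s * Real.sign (blochDot θ x)) / 2) =
      !![(((1 + 2 / Real.pi * s * Real.cos θ) / 4 : ℝ) : ℂ),
        ((2 / Real.pi * s * Real.sin θ / 4 : ℝ) : ℂ);
        ((2 / Real.pi * s * Real.sin θ / 4 : ℝ) : ℂ),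
        (((1 - 2 / Real.pi * s * Real.cos θ) / 4 : ℝ) : ℂ)] := by
  have h00 := integral_uniformRP1_bloch_mul_response (1 / 2) (1 / 2) 0 s θ
  have h01 := integral_uniformRP1_bloch_mul_response 0 0 (1 / 2) s θ
  have h11 := integral_uniformRP1_bloch_mul_response (1 / 2) (-1 / 2) 0 s θ
  have e00 : ∀ x : RP1, ((x : QubitOp) 0 0).re = 1 / 2 + 1 / 2 * blochZ x + 0 * blochX x :=
    fun x => by rw [coe_eq_bloch x]; exact (Complex.ofReal_re _).trans (by ring)
  have e01 : ∀ x : RP1, ((x : QubitOp) 0 1).re = 0 + 0 * blochZ x + 1 / 2 * blochX x :=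
    fun x => by rw [coe_eq_bloch x]; exact (Complex.ofReal_re _).trans (by ring)
  have e10 : ∀ x : RP1, ((x : QubitOp) 1 0).re = 0 + 0 * blochZ x + 1 / 2 * blochX x :=
    fun x => by rw [coe_eq_bloch x]; exact (Complex.ofReal_re _).trans (by ring)
  have e11 : ∀ x : RP1, ((x : QubitOp) 1 1).re = 1 / 2 + -1 / 2 * blochZ x + 0 * blochX x :=
    fun x => by rw [coe_eq_bloch x]; exact (Complex.ofReal_re _).trans (by ring)
  ext i j
  rw [boxIntegral_apply]
  fin_cases i <;> fin_cases j <;>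
    simp only [Fin.zero_eta, Fin.mk_one, Fin.isValue, e00, e01, e10, e11, h00, h01, h11,
      Matrix.of_apply, Matrix.cons_val', Matrix.cons_val_zero, Matrix.cons_val_one,
      Matrix.cons_val_fin_one, Complex.ofReal_inj] <;> ring

theorem rpUnsteerable_wernerState {η : ℝ} (h0 : 0 ≤ η) (h : η ≤ 2 / Real.pi) :
    RPUnsteerable (wernerState η) := by
  have hpi := Real.pi_pos
  -- Solves (2/π) s = η; the hypothesis on η says exactly that s ≤ 1, which keeps the responses in
  -- [0, 1].
  set s : ℝ := η * Real.pi / 2 with hs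
  have hs0 : 0 ≤ s := by positivity
  have hs1 : s ≤ 1 := by
    rw [le_div_iff₀ hpi] at h
    rw [hs]; linarith
  have hη : 2 / Real.pi * s = η := by rw [hs]; field_simp
  have hbd : ∀ (a : Fin 2) (r : ℝ), |s * (-1) ^ (a : ℕ) * Real.sign r| ≤ 1 := fun a r => by
    rw [abs_mul, abs_mul, abs_pow, abs_neg, abs_one, one_pow, mul_one, abs_of_nonneg hs0]
    exact mul_le_one₀ hs1 (abs_nonneg _) (Real.abs_sign_le_one r)
  refine ⟨uniformRP1,
    fun θ a x => (1 + s * (-1) ^ (a : ℕ) * Real.sign (blochDot θ x)) / 2, inferInstance,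
    fun θ a => ?_, fun θ a x => ?_, fun θ x => ?_, fun θ a => ?_⟩
  · exact (measurable_const.add
      ((Real.measurable_sign.comp (measurable_blochDot θ)).const_mul _)).div_const 2
  · have := abs_le.1 (hbd a (blochDot θ x))
    constructor <;> linarith [this.1, this.2]
  · simp only [Fin.sum_univ_two, Fin.val_zero, Fin.val_one, pow_zero, pow_one]
    ring
  · rw [boxIntegral_uniformRP1, realProjectiveAssemblage, steeringEllipse_wernerState,
      Real.cos_add_nat_mul_pi, Real.sin_add_nat_mul_pi, ← mul_assoc (2 / Real.pi), hη,
      mul_assoc η, mul_assoc η]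

/-! ### The steering bound -/

theorem integrable_blochDot_mul (μ : Measure RP1) [IsProbabilityMeasure μ] (θ : ℝ) {f : RP1 → ℝ}
    (hf : Measurable f) (hf1 : ∀ x, f x ∈ Set.Icc (0 : ℝ) 1) :
    Integrable (fun x => blochDot θ x * f x) μ := by
  refine Integrable.of_bound ((measurable_blochDot θ).mul hf).aestronglyMeasurable 1
    (.of_forall fun x => ?_)
  rw [Real.norm_eq_abs, abs_mul, abs_of_nonneg (hf1 x).1]
  exact mul_le_one₀ (abs_blochDot_le_one θ x) (hf1 x).1 (hf1 x).2

/-- The pairing with cos θ Z + sin θ X is linear, so it depends on the model only through Bob's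
state. -/
theorem integral_blochDot_mul (μ : Measure RP1) [IsProbabilityMeasure μ] (θ : ℝ) {f : RP1 → ℝ}
    (hf : Measurable f) (hf1 : ∀ x, f x ∈ Set.Icc (0 : ℝ) 1) :
    ∫ x, blochDot θ x * f x ∂μ =
      Real.cos θ * ((boxIntegral μ f 0 0).re - (boxIntegral μ f 1 1).re) +
        Real.sin θ * (2 * (boxIntegral μ f 0 1).re) := by
  have hint : ∀ i j, Integrable (fun x : RP1 => ((x : QubitOp) i j).re * f x) μ := fun i j => by
    refine Integrable.of_bound ((continuous_re_entry i j).measurable.mul hf).aestronglyMeasurable 1 (.of_forall fun x => ?_)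
    rw [Real.norm_eq_abs, abs_mul, abs_of_nonneg (hf1 x).1]
    refine mul_le_one₀ ?_ (hf1 x).1 (hf1 x).2
    have hZ := abs_le.1 (abs_blochZ_le_one x)
    have hX := abs_le.1 (abs_blochX_le_one x)
    rw [coe_eq_bloch x, abs_le]
    fin_cases i <;> fin_cases j <;> simp <;> constructor <;> linarith [hZ.1, hZ.2, hX.1, hX.2]
  simp only [boxIntegral_apply, Complex.ofReal_re]
  rw [← integral_sub (hint 0 0) (hint 1 1), ← integral_const_mul 2, ← integral_const_mul,
    ← integral_const_mul]
  refine Eq.trans ?_ (integral_add (((hint 0 0).sub (hint 1 1)).const_mul _)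
    (((hint 0 1).const_mul 2).const_mul _))
  refine integral_congr_ae (.of_forall fun x => ?_)
  simp only [blochDot, blochZ, blochX]
  ring

/-- By Fubini, each hidden state contributes 4 whatever its angle, so μ drops out. -/
theorem integral_integral_abs_blochDot (μ : Measure RP1) [IsProbabilityMeasure μ] :
    ∫ θ in (0)..(2 * Real.pi), ∫ x, |blochDot θ x| ∂μ = 4 := by
  have hm : Measurable fun p : ℝ × RP1 => |blochDot p.1 p.2| :=
    (((Real.measurable_cos.comp measurable_fst).mul (measurable_blochZ.comp measurable_snd)).add
      ((Real.measurable_sin.comp measurable_fst).mul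
        (measurable_blochX.comp measurable_snd))).abs
  rw [intervalIntegral.integral_of_le Real.two_pi_pos.le, integral_integral_swap]
  · have h : ∀ x : RP1, ∫ θ in Set.Ioc 0 (2 * Real.pi), |blochDot θ x| = 4 := fun x => by
      obtain ⟨φ, rfl⟩ := exists_angleProj_eq x
      simp only [blochDot_angleProj]
      rw [← intervalIntegral.integral_of_le Real.two_pi_pos.le, integral_abs_cos_sub]
    simp [h]
  · refine Integrable.of_bound hm.aestronglyMeasurable 1 (.of_forall fun p => ?_)
    simpa [Function.uncurry] using abs_blochDot_le_one p.1 p.2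

theorem le_two_div_pi_of_rpUnsteerable {η : ℝ} (h : RPUnsteerable (wernerState η)) :
    η ≤ 2 / Real.pi := by
  obtain ⟨μ, f, hμ, hf, hf1, hsum, hσ⟩ := h
  have hval : ∀ (θ : ℝ) (a : Fin 2),
      ∫ x, blochDot θ x * f θ a x ∂μ = (-1) ^ (a : ℕ) * (η / 2) := fun θ a => by
    rw [integral_blochDot_mul μ θ (hf θ a) (hf1 θ a), ← hσ, realProjectiveAssemblage,
      steeringEllipse_wernerState, Real.cos_add_nat_mul_pi, Real.sin_add_nat_mul_pi]
    simp only [Matrix.of_apply, Matrix.cons_val', Matrix.cons_val_zero, Matrix.cons_val_one,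
      Matrix.cons_val_fin_one, Complex.ofReal_re]
    linear_combination (-1) ^ (a : ℕ) * (η / 2) * Real.sin_sq_add_cos_sq θ
  have hle : ∀ θ : ℝ, η ≤ ∫ x, |blochDot θ x| ∂μ := fun θ => by
    have hint := fun a => integrable_blochDot_mul μ θ (hf θ a) (hf1 θ a)
    have hη : η = ∫ x, (blochDot θ x * f θ 0 x - blochDot θ x * f θ 1 x) ∂μ := by
      rw [integral_sub (hint 0) (hint 1), hval, hval]
      simp
    rw [hη]
    refine integral_mono ((hint 0).sub (hint 1)) ?_ fun x => ?_
    · exact Integrable.of_bound (measurable_blochDot θ).abs.aestronglyMeasurable 1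
        (.of_forall fun x => by simpa using abs_blochDot_le_one θ x)
    · have h0 := hf1 θ 0 x
      have h1 := hf1 θ 1 x
      calc blochDot θ x * f θ 0 x - blochDot θ x * f θ 1 x
          ≤ |blochDot θ x * (f θ 0 x - f θ 1 x)| := by rw [← mul_sub]; exact le_abs_self _
        _ ≤ |blochDot θ x| := by
          rw [abs_mul]
          refine mul_le_of_le_one_right (abs_nonneg _) (abs_le.2 ⟨?_, ?_⟩) <;>
            linarith [h0.1, h0.2, h1.1, h1.2]
  have htotal : ∫ _θ in (0)..(2 * Real.pi), η ≤ 4 := by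
    have h4 := integral_integral_abs_blochDot μ
    rw [← h4]
    refine intervalIntegral.integral_mono_on Real.two_pi_pos.le intervalIntegrable_const ?_
      fun θ _ => hle θ
    -- A non-integrable function would have integral 0 by convention, but the value is 4.
    exact intervalIntegral.intervalIntegrable_of_integral_ne_zero (by rw [h4]; norm_num)
  rw [intervalIntegral.integral_const, sub_zero, smul_eq_mul] at htotal
  rw [le_div_iff₀ Real.pi_pos]
  linarith

theorem theorem3 (η : ℝ) (hη : η ∈ Set.Icc (0 : ℝ) 1) :
    (η ≤ 2 / Real.pi → RPUnsteerable (wernerState η)) ∧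
      (2 / Real.pi < η → RPSteerable (wernerState η)) :=
  ⟨rpUnsteerable_wernerState hη.1,
    fun h hU => (le_two_div_pi_of_rpUnsteerable hU).not_gt h⟩
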